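/- **Setting.** Let $\mathbb T=\mathbb R/2\pi\mathbb Z$, with $L^2(\mathbb T)$ normed by the normalised measure, let $\hat v(k)$ be the Fourier coefficients of $v$, let $\gamma\in(0,1]$, and let $H^\gamma(\mathbb T)$ be the space of complex-valued $v\in L^2(\mathbb T)$ with $\|v\|_{H^\gamma}^2=\sum_k(1+k^2)^\gamma|\hat v(k)|^2<\infty$. Consider a dispersive equation $$\partial_t u+i\mathcal L u=\mathcal N(u),\qquad \widehat{\mathcal Lu}(k)=\omega(k)\hat u(k),\quad \omega:\mathbb Z\to\mathbb R,\qquad \mathcal N(u)=\sum_{j} m_j(D)\bigl(u^{a_j}\bar u^{\,b_j}\bigr),$$ where the sum is finite, $a_j,b_j\in\mathbb N$, and $m_j(D)$ is the Fourier multiplier with symbol $m_j:\mathbb Z\to\mathbb C$. Put $\mathcal U(t)=e^{-it\mathcal L}$. A solution on $[0,T]$ is a $u\in C([0,T];H^\gamma(\mathbb T))$ with $u(t)=\mathcal U(t)u(0)+\int_0^t\mathcal U(t-\sigma)\mathcal N(u(\sigma))\,d\sigma$ in every Fourier mode, where the monomials $u^{a_j}\bar u^{\,b_j}$ are integrable on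 $\mathbb T$ for a.e. $t$ and the Fourier coefficients of $\mathcal N(u(t))$ are integrable in $t$. A base low-regularity integrator is a map $\mathcal I_{LRI}(\cdot,\tau):H^\gamma\to H^\gamma$ for each step size $\tau$; its step is $\mathcal H_{phys}(v)=\mathcal U(\tau)v+\mathcal I_{LRI}(v,\tau)$. If $w$ is a solution on $[0,\tau]$ with $w(0)=v$, the defect at $v$ is $\mathcal E_{defect}(v,\tau)=\mathcal I_{exact}(v,\tau)-\mathcal I_{LRI}(v,\tau)$ with $\mathcal I_{exact}(v,\tau)=\int_0^\tau\mathcal U(\tau-\sigma)\mathcal N(w(\sigma))\,d\sigma=w(\tau)-\mathcal U(\tau)v$. The neural correction is $\mathcal H_{neural}=\mathbf P\circ\mathcal G_\theta\circ\mathbf R$. Here $\mathbf R=\Phi^*$ acts on the vector of the $N$ Fourier coefficients $\hat v(k)$, $-\lfloor N/2\rfloor\le k<\lceil N/2\rceil$, with a matrix $\Phi\in\mathbb C^{N\times K}$; $\mathbf P=\Phi$ maps back to trigonometric polynomials in these modes; and $\mathcal G_\theta:\mathbb C^K\to\mathbb C^K$ is a feed-forward network whose layers are $z\mapsto\sigma_l(\mathbf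 W^{(l)}z+b^{(l)})$, with scalar activations $\sigma_l$ applied componentwise. Put $L_{\theta,K}=\prod_l\|\mathbf W^{(l)}\|_2$. The HIN-LRI iterates are $u^0_{HIN}=u(0)$, $u^{n+1}_{HIN}=\mathcal H_{phys}(u^n_{HIN})+\tau\,\mathcal H_{neural}(u^n_{HIN})$. **Assumptions**, for $T>0$ and constants $R$, $C_0,C_D\ge0$, $\Lambda$, $\rho,\tau_1>0$, and for a step size $\tau$: 1. $\mathcal K\subset H^\gamma(\mathbb T)$ is compact, $\|v\|_{H^\gamma}\le R$ on $\mathcal K$, and the exact solution $u$ on $[0,T]$ under consideration has $u(t)\in\mathcal K$ for all $t\in[0,T]$. 2. The activations of $\mathcal G_\theta$ are Lipschitz with a constant $\kappa$, and $\kappa^{\mathrm{depth}}L_{\theta,K}\le\Lambda$. 3. $\Phi^*\Phi=I_K$. 4. $\varepsilon_{net}\in[0,1]$, $\delta\ge0$, and for all $v\in\mathcal K$ (and all solutions on $[0,\tau]$ starting at $v$) $$\|\tau\mathcal H_{neural}(v)-\mathcal E_{defect}(v,\tau)\|_{L^2}\le(\varepsilon_{net}+\delta)\,C_D\,\tau^{1+\gamma}\ln(1/\tau)\,\|v\|_{H^\gamma}^3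 .$$ 5. The base integrator converges: there is $A$ such that $\|w(n\tau')-\mathcal H_{phys}^n(w(0))\|_{L^2}\le A\tau'^{\gamma}$ for all $\tau'\in(0,\tau_1]$ (with $\mathcal H_{phys}$ taken at step size $\tau'$), $n\tau'\le T$, and all solutions $w$ on $[0,T]$ with values in $\mathcal K$. It is also Lipschitz-stable near $\mathcal K$: $\|\mathcal H_{phys}(v)-\mathcal H_{phys}(w)\|_{L^2}\le(1+C_0\tau')\|v-w\|_{L^2}$ for all $\tau'\in(0,\tau_1]$, $v\in\mathcal K$, $w\in H^\gamma$ with $\|v-w\|_{L^2}\le\rho$. **Theorem (Main Convergence Theorem).** For all $\gamma\in(0,1]$, $T>0$, $R$, $C_0,C_D\ge0$, $\Lambda$ there is a constant $C>0$, and for all $\rho,\tau_1>0$ and $B$ there is $\tau_0>0$, such that the following holds for every equation, every base integrator, every $\mathcal K$ and every solution $u$ on $[0,T]$ with mean-zero data $\int_{\mathbb T}u(0)\,dx=0$, all $\varepsilon_{net},\delta$ with $\varepsilon_{net}+\delta\le B$, every $\tau\in(0,\tau_0]$, and all $N,K$, $\Phi$ and $\mathcal G_\theta$ (which may depend on $\tau$):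 if Assumptions 1–5 and the step-size condition $\tau L_{\theta,K}<1$ hold, then $$\|u(n\tau)-u^n_{HIN}\|_{L^2}\le C(\varepsilon_{net}+\delta)\,\tau^\gamma\ln(1/\tau)\qquad\text{for all }n\ge1\text{ with }n\tau\le T.$$ In particular $C$ and $\tau_0$ depend only on the listed constants, not on $u$, $N$, $K$, the network or $\tau$. -/

import Mathlib

open MeasureTheory Set

noncomputable section

namespace HINLRI

/-! ### Function spaces on the torus of length 2π -/

instance fact_two_pi_pos : Fact (0 < 2 * Real.pi) := ⟨Real.two_pi_pos⟩

/-- The torus of length `2π`. -/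
abbrev Torus : Type := AddCircle (2 * Real.pi)

/-- Complex-valued square-integrable functions on the torus (normalised Haar measure). -/
abbrev L2T : Type := Lp ℂ 2 (AddCircle.haarAddCircle (T := 2 * Real.pi))

/-- The Fourier coefficient of an `L²` function. -/
def coeff (f : L2T) (k : ℤ) : ℂ := fourierCoeff (f : Torus → ℂ) k

theorem coeff_eq_repr (f : L2T) (k : ℤ) : coeff f k = fourierBasis.repr f k :=
  (fourierBasis_repr f k).symm

theorem coeff_add (f g : L2T) (k : ℤ) : coeff (f + g) k = coeff f k + coeff g k := by
  simp [coeff_eq_repr]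

theorem coeff_smul (c : ℂ) (f : L2T) (k : ℤ) : coeff (c • f) k = c * coeff f k := by
  simp [coeff_eq_repr]

theorem coeff_injective {f g : L2T} (h : ∀ k, coeff f k = coeff g k) : f = g := by
  apply fourierBasis.repr.injective
  ext k
  simpa [coeff_eq_repr] using h k

/-- The weight `⟨k⟩^γ = (1 + k²)^(γ/2)`. -/
def weight (γ : ℝ) (k : ℤ) : ℝ := (1 + (k : ℝ) ^ 2) ^ (γ / 2)

theorem weight_pos (γ : ℝ) (k : ℤ) : 0 < weight γ k := by
  unfold weight
  positivity

/-- The functions in `L²` whose weighted Fourier coefficients `⟨k⟩^γ f̂(k)` are square-summable. -/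
def sobolevSubmodule (γ : ℝ) : Submodule ℂ L2T where
  carrier := {f | Memℓp (fun k : ℤ => (weight γ k : ℂ) * coeff f k) 2}
  zero_mem' := by
    have h : (fun k : ℤ => (weight γ k : ℂ) * coeff 0 k) = 0 := by
      funext k
      simp [coeff_eq_repr]
    show Memℓp _ 2
    rw [h]
    exact zero_memℓp
  add_mem' := by
    intro f g hf hg
    have h : (fun k : ℤ => (weight γ k : ℂ) * coeff (f + g) k)
        = (fun k : ℤ => (weight γ k : ℂ) * coeff f k)
          + (fun k : ℤ => (weight γ k : ℂ) * coeff g k) := by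
      funext k
      simp [coeff_add, mul_add]
    show Memℓp _ 2
    rw [h]
    exact Memℓp.add hf hg
  smul_mem' := by
    intro c f hf
    have h : (fun k : ℤ => (weight γ k : ℂ) * coeff (c • f) k)
        = c • (fun k : ℤ => (weight γ k : ℂ) * coeff f k) := by
      funext k
      simp only [coeff_smul, Pi.smul_apply, smul_eq_mul]
      ring
    show Memℓp _ 2
    rw [h]
    exact Memℓp.const_smul hf c

/-- The Sobolev space `H^γ` of the torus (for `γ ≥ 0`), with its own norm, defined below. -/
def Hs (γ : ℝ) : Type := sobolevSubmodule γ

variable {γ : ℝ}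

instance : AddCommGroup (Hs γ) := inferInstanceAs (AddCommGroup (sobolevSubmodule γ))

instance : Module ℂ (Hs γ) := inferInstanceAs (Module ℂ (sobolevSubmodule γ))

/-- The inclusion of `H^γ` into `L²`. -/
def toL2 : Hs γ →ₗ[ℂ] L2T := (sobolevSubmodule γ).subtype

/-- The `k`-th Fourier coefficient of an element of `H^γ`. -/
def hcoeff (v : Hs γ) (k : ℤ) : ℂ := coeff (toL2 v) k

theorem hcoeff_injective {v w : Hs γ} (h : ∀ k, hcoeff v k = hcoeff w k) : v = w :=
  Subtype.ext (coeff_injective h)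

theorem hcoeff_add (v w : Hs γ) (k : ℤ) : hcoeff (v + w) k = hcoeff v k + hcoeff w k := by
  simp [hcoeff, coeff_add]

theorem hcoeff_smul (c : ℂ) (v : Hs γ) (k : ℤ) : hcoeff (c • v) k = c * hcoeff v k := by
  simp [hcoeff, coeff_smul]

/-- The weighted coefficient sequence `(⟨k⟩^γ v̂(k))` of `v ∈ H^γ`, as an element of `ℓ²`. -/
def weightedCoeff : Hs γ →ₗ[ℂ] lp (fun _ : ℤ => ℂ) 2 where
  toFun v := ⟨fun k => (weight γ k : ℂ) * hcoeff v k, v.2⟩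
  map_add' v w := by
    ext k
    show (weight γ k : ℂ) * hcoeff (v + w) k
      = (weight γ k : ℂ) * hcoeff v k + (weight γ k : ℂ) * hcoeff w k
    rw [hcoeff_add, mul_add]
  map_smul' c v := by
    ext k
    show (weight γ k : ℂ) * hcoeff (c • v) k = c * ((weight γ k : ℂ) * hcoeff v k)
    rw [hcoeff_smul]
    ring

theorem weightedCoeff_injective : Function.Injective (weightedCoeff (γ := γ)) := by
  intro v w h
  apply hcoeff_injective
  intro k
  have hk : (weight γ k : ℂ) * hcoeff v k = (weight γ k : ℂ) * hcoeff w k :=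
    congrFun (congrArg Subtype.val h) k
  exact mul_left_cancel₀ (Complex.ofReal_ne_zero.mpr (weight_pos γ k).ne') hk

/-- `H^γ` carries the norm `‖v‖² = ∑ (1 + k²)^γ |v̂(k)|²`. -/
instance : NormedAddCommGroup (Hs γ) :=
  NormedAddCommGroup.induced (Hs γ) (lp (fun _ : ℤ => ℂ) 2) weightedCoeff weightedCoeff_injective

theorem norm_sq_eq (v : Hs γ) :
    ‖v‖ ^ 2 = ∑' k : ℤ, (1 + (k : ℝ) ^ 2) ^ γ * ‖hcoeff v k‖ ^ 2 := by
  have h := lp.norm_rpow_eq_tsum (p := 2) (by norm_num) (weightedCoeff v)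
  have h2 : ‖v‖ = ‖weightedCoeff v‖ := rfl
  rw [h2]
  simp only [ENNReal.toReal_ofNat, Real.rpow_ofNat] at h
  rw [h]
  refine tsum_congr fun k => ?_
  show ‖(weight γ k : ℂ) * hcoeff v k‖ ^ 2 = _
  rw [norm_mul, mul_pow, Complex.norm_real, Real.norm_of_nonneg (weight_pos γ k).le, weight,
    ← Real.rpow_natCast, ← Real.rpow_mul (by positivity)]
  norm_num

/-- The exponential `x ↦ e^{ikx}` as an element of `H^γ`. -/
def expHs (k : ℤ) : Hs γ :=
  ⟨fourierLp 2 k, by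
    have hc : ∀ j : ℤ, coeff (fourierLp 2 k) j = if j = k then 1 else 0 := by
      intro j
      rw [coeff_eq_repr, ← coe_fourierBasis, HilbertBasis.repr_self]
      simp [lp.single_apply, Pi.single_apply]
    show Memℓp _ 2
    refine (memℓp_gen_iff (by norm_num)).2 ?_
    refine summable_of_ne_finset_zero (s := {k}) ?_
    intro j hj
    have : j ≠ k := by simpa using hj
    simp [hc, this]⟩

/-! ### Nonlinear dispersive equations `∂ₜu + i𝓛u = 𝓝(u)` -/

/-- A dispersive equation on the torus: `𝓛` has the real symbol `ω`, and
`𝓝(u) = ∑ⱼ mⱼ(D) (u^{aⱼ} ū^{bⱼ})` is a polynomial nonlinearity with Fourier multipliers `mⱼ(k)`.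
For instance `ω(k) = -k³`, `m(k) = ik/2`, `a = 2`, `b = 0` gives `𝓝(u) = ∂ₓ(u²)/2`,
and `ω(k) = k²`, `m(k) = c`, `a = 2`, `b = 1` gives `𝓝(u) = c|u|²u`. -/
structure DispersiveEq where
  ω : ℤ → ℝ
  numTerms : ℕ
  a : Fin numTerms → ℕ
  b : Fin numTerms → ℕ
  m : Fin numTerms → ℤ → ℂ

/-- The monomial `u^{aⱼ} ū^{bⱼ}`. -/
def DispersiveEq.monomial (E : DispersiveEq) (j : Fin E.numTerms) (v : Hs γ) : Torus → ℂ :=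
  fun x => (toL2 v : Torus → ℂ) x ^ E.a j * (starRingEnd ℂ) ((toL2 v : Torus → ℂ) x) ^ E.b j

/-- The `k`-th Fourier coefficient of `𝓝(v)`. -/
def DispersiveEq.nonlinCoeff (E : DispersiveEq) (v : Hs γ) (k : ℤ) : ℂ :=
  ∑ j, E.m j k * fourierCoeff (E.monomial j v) k

/-- The phase factor `e^{-itω(k)}`. -/
def DispersiveEq.phase (E : DispersiveEq) (t : ℝ) (k : ℤ) : ℂ :=
  Complex.exp (-Complex.I * (t * E.ω k : ℝ))

theorem DispersiveEq.norm_phase (E : DispersiveEq) (t : ℝ) (k : ℤ) : ‖E.phase t k‖ = 1 := by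
  rw [phase, show -Complex.I * ((t * E.ω k : ℝ) : ℂ) = ((-(t * E.ω k) : ℝ) : ℂ) * Complex.I by
    push_cast; ring]
  exact Complex.norm_exp_ofReal_mul_I _

theorem DispersiveEq.memℓp_phase (E : DispersiveEq) (t : ℝ) (v : Hs γ) :
    Memℓp (fun k => E.phase t k * hcoeff v k) 2 := by
  refine (memℓp_gen_iff (by norm_num)).2 ?_
  refine ((memℓp_gen_iff (by norm_num)).1 (fourierBasis.repr (toL2 v)).2).congr fun k => ?_
  rw [norm_mul, E.norm_phase, one_mul, hcoeff, coeff_eq_repr]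

/-- The function with Fourier coefficients `e^{-itω(k)} v̂(k)`, in `L²`. -/
def DispersiveEq.propagatorL2 (E : DispersiveEq) (t : ℝ) (v : Hs γ) : L2T :=
  fourierBasis.repr.symm ⟨_, E.memℓp_phase t v⟩

theorem DispersiveEq.coeff_propagatorL2 (E : DispersiveEq) (t : ℝ) (v : Hs γ) (k : ℤ) :
    coeff (E.propagatorL2 t v) k = E.phase t k * hcoeff v k := by
  rw [coeff_eq_repr, propagatorL2, LinearIsometryEquiv.apply_symm_apply]

/-- The linear propagator `𝓤(t) = exp(-it𝓛)` on `H^γ`: it multiplies the `k`-th Fourier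
coefficient by `e^{-itω(k)}`. -/
def DispersiveEq.propagator (E : DispersiveEq) (t : ℝ) (v : Hs γ) : Hs γ :=
  ⟨E.propagatorL2 t v, by
    show Memℓp (fun k => (weight γ k : ℂ) * coeff (E.propagatorL2 t v) k) 2
    refine (memℓp_gen_iff (by norm_num)).2 ?_
    refine ((memℓp_gen_iff (by norm_num)).1 (weightedCoeff v).2).congr fun k => ?_
    show ‖(weight γ k : ℂ) * hcoeff v k‖ ^ _ = _
    rw [E.coeff_propagatorL2, norm_mul, norm_mul, norm_mul, E.norm_phase, one_mul]⟩

theorem DispersiveEq.hcoeff_propagator (E : DispersiveEq) (t : ℝ) (v : Hs γ) (k : ℤ) :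
    hcoeff (E.propagator t v) k = E.phase t k * hcoeff v k :=
  E.coeff_propagatorL2 t v k

/-- The `k`-th Fourier coefficient of `∫₀ᵗ 𝓤(t-σ) 𝓝(u(σ)) dσ`. -/
def DispersiveEq.duhamelCoeff (E : DispersiveEq) (u : ℝ → Hs γ) (t : ℝ) (k : ℤ) : ℂ :=
  ∫ σ in (0 : ℝ)..t, E.phase (t - σ) k * E.nonlinCoeff (u σ) k

/-- `u ∈ C([0,T]; H^γ)` solves `∂ₜu + i𝓛u = 𝓝(u)` on `[0,T]` in Duhamel form, i.e.
`u(t) = 𝓤(t)u(0) + ∫₀ᵗ 𝓤(t-σ)𝓝(u(σ))dσ`, read off Fourier mode by Fourier mode. -/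
structure IsSolution (E : DispersiveEq) (T : ℝ) (u : ℝ → Hs γ) : Prop where
  continuousOn : ContinuousOn u (Icc 0 T)
  integrable_monomial : ∀ᵐ t ∂(volume.restrict (Icc 0 T)), ∀ j,
    Integrable (E.monomial j (u t)) AddCircle.haarAddCircle
  integrable_nonlin : ∀ k, IntervalIntegrable (fun t => E.nonlinCoeff (u t) k) volume 0 T
  duhamel : ∀ t ∈ Icc 0 T, ∀ k,
    hcoeff (u t) k = hcoeff (E.propagator t (u 0)) k + E.duhamelCoeff u t k

/-! ### The base integrator and its defect -/

/-- The base step `𝓗_phys(v) = 𝓤(τ)v + 𝓘_LRI(v,τ)` built from a base integrator `I = 𝓘_LRI`. -/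
def physStep (E : DispersiveEq) (I : ℝ → Hs γ → Hs γ) (τ : ℝ) (v : Hs γ) : Hs γ :=
  E.propagator τ v + I τ v

/-- The exact Duhamel increment `𝓘_exact = u(τ) - 𝓤(τ)u(0) = ∫₀^τ 𝓤(τ-σ)𝓝(u(σ))dσ` over a step
of length `τ`, for a solution `u` (see `hcoeff_exactIncrement`). -/
def exactIncrement (E : DispersiveEq) (u : ℝ → Hs γ) (τ : ℝ) : Hs γ :=
  u τ - E.propagator τ (u 0)

theorem hcoeff_exactIncrement {E : DispersiveEq} {u : ℝ → Hs γ} {τ : ℝ} (hτ : 0 ≤ τ)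
    (hu : IsSolution E τ u) (k : ℤ) : hcoeff (exactIncrement E u τ) k = E.duhamelCoeff u τ k := by
  have h := hu.duhamel τ ⟨hτ, le_rfl⟩ k
  have h2 := hcoeff_add (exactIncrement E u τ) (E.propagator τ (u 0)) k
  rw [exactIncrement, sub_add_cancel] at h2
  rw [h2] at h
  rw [exactIncrement]
  linear_combination h

/-- The defect `𝓔_defect = 𝓘_exact - 𝓘_LRI` at the initial state of the solution `u`. -/
def defect (E : DispersiveEq) (I : ℝ → Hs γ → Hs γ) (u : ℝ → Hs γ) (τ : ℝ) : Hs γ :=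
  exactIncrement E u τ - I τ (u 0)

/-- The base integrator converges at rate `τ^γ` in `L²` on `[0,T]`, along the exact solutions
with values in `K`, for step sizes `τ ≤ τ₁`. -/
def BaseConvergent (E : DispersiveEq) (I : ℝ → Hs γ → Hs γ) (K : Set (Hs γ)) (T τ₁ : ℝ) : Prop :=
  ∃ A : ℝ, ∀ τ ∈ Ioc 0 τ₁, ∀ u : ℝ → Hs γ, IsSolution E T u → (∀ t ∈ Icc 0 T, u t ∈ K) →
    ∀ n : ℕ, n * τ ≤ T → ‖toL2 (u (n * τ) - (physStep E I τ)^[n] (u 0))‖ ≤ A * τ ^ γ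

/-- The base step is Lipschitz-stable in `L²` with constant `1 + C₀τ` near `K`, for `τ ≤ τ₁`:
one of the two states is in `K`, the other one is any state in `H^γ` at `L²` distance
at most `ρ` from it. -/
def BaseStable (E : DispersiveEq) (I : ℝ → Hs γ → Hs γ) (K : Set (Hs γ)) (C₀ ρ τ₁ : ℝ) : Prop :=
  ∀ τ ∈ Ioc 0 τ₁, ∀ v ∈ K, ∀ w : Hs γ, ‖toL2 (v - w)‖ ≤ ρ →
    ‖toL2 (physStep E I τ v - physStep E I τ w)‖ ≤ (1 + C₀ * τ) * ‖toL2 (v - w)‖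

/-! ### The latent neural corrector -/

/-- Feed-forward networks `ℂⁿ → ℂᵖ` with Euclidean norms: each layer is an affine map (weight `W`,
bias `b`) followed by a scalar activation `s` applied to every component. -/
inductive Net (n : ℕ) : ℕ → Type where
  | input : Net n n
  | layer {q p : ℕ} (net : Net n q)
      (W : EuclideanSpace ℂ (Fin q) →L[ℂ] EuclideanSpace ℂ (Fin p))
      (b : EuclideanSpace ℂ (Fin p)) (s : ℂ → ℂ) : Net n p

/-- The function computed by a network. -/
def Net.eval {n : ℕ} : {p : ℕ} → Net n p → EuclideanSpace ℂ (Fin n) → EuclideanSpace ℂ (Fin p)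
  | _, .input, z => z
  | _, .layer net W b s, z => WithLp.toLp 2 fun i => s ((W (net.eval z) + b) i)

/-- The number of layers. -/
def Net.depth {n : ℕ} : {p : ℕ} → Net n p → ℕ
  | _, .input => 0
  | _, .layer net _ _ _ => net.depth + 1

/-- The product of the spectral norms of the weights of all layers. -/
def Net.weightProd {n : ℕ} : {p : ℕ} → Net n p → ℝ
  | _, .input => 1
  | _, .layer net W _ _ => net.weightProd * ‖W‖

/-- All activations are Lipschitz continuous with constant `κ`. -/
def Net.ActivationsLipschitz {n : ℕ} (κ : NNReal) : {p : ℕ} → Net n p → Prop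
  | _, .input => True
  | _, .layer net _ _ s => net.ActivationsLipschitz κ ∧ LipschitzWith κ s

/-- The `j`-th of the `N` Fourier modes `-⌊N/2⌋, …, ⌈N/2⌉ - 1` of the spectral grid. -/
def gridMode {N : ℕ} (j : Fin N) : ℤ := (j : ℤ) - (N : ℤ) / 2

/-- The restriction `𝐑 = Φ*`, applied to the `N` grid modes of a function. -/
def restriction {N d : ℕ} (Φ : Matrix (Fin N) (Fin d) ℂ) (v : Hs γ) : EuclideanSpace ℂ (Fin d) :=
  WithLp.toLp 2 (Φ.conjTranspose.mulVec fun j => hcoeff v (gridMode j))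

/-- The prolongation `𝐏 = Φ`, from latent vectors to trigonometric polynomials. -/
def prolongation {N d : ℕ} (Φ : Matrix (Fin N) (Fin d) ℂ) (z : EuclideanSpace ℂ (Fin d)) : Hs γ :=
  ∑ j, Φ.mulVec z.ofLp j • expHs (gridMode j)

/-- The neural correction `𝓗_neural = 𝐏 ∘ 𝓖_θ ∘ 𝐑`. -/
def neural {N d : ℕ} (Φ : Matrix (Fin N) (Fin d) ℂ) (G : Net d d) (v : Hs γ) : Hs γ :=
  prolongation Φ (G.eval (restriction Φ v))

/-- The HIN-LRI step `𝓢(v) = 𝓗_phys(v) + τ 𝓗_neural(v)`. -/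
def hinStep (E : DispersiveEq) (I : ℝ → Hs γ → Hs γ) {N d : ℕ} (Φ : Matrix (Fin N) (Fin d) ℂ)
    (G : Net d d) (τ : ℝ) (v : Hs γ) : Hs γ :=
  physStep E I τ v + (τ : ℂ) • neural Φ G v

/-- Training quality at step size `τ`: on the data set `K`, the correction `τ 𝓗_neural` matches the
defect in `L²` up to `(ε + δ) D(v,τ)`, where `D(v,τ) = C_D τ^{1+γ} ln(1/τ) ‖v‖³_{H^γ}`. -/
def TrainingQuality (E : DispersiveEq) (I : ℝ → Hs γ → Hs γ) (K : Set (Hs γ)) {N d : ℕ}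
    (Φ : Matrix (Fin N) (Fin d) ℂ) (G : Net d d) (C_D ε δ τ : ℝ) : Prop :=
  ∀ u : ℝ → Hs γ, IsSolution E τ u → u 0 ∈ K →
    ‖toL2 ((τ : ℂ) • neural Φ G (u 0) - defect E I u τ)‖
      ≤ (ε + δ) * (C_D * τ ^ (1 + γ) * Real.log (1 / τ) * ‖u 0‖ ^ 3)

end HINLRI

end

namespace HINLRI

open Filter Topology
open scoped Matrix.Norms.L2Operator

variable {γ : ℝ}

/-! ### Time translation of solutions -/

/-! This is consistency plus stability, closed by a bootstrap. One corrected step from an exact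
value `u s` misses `u (s + τ)` by exactly the training residual `τ • neural - defect`, up to sign,
because the linear flow and the base increment cancel. Assumption 4 thus bounds the local error by
`τ` times a multiple of `(ε + δ) τ^γ ln(1/τ)` (`norm_toL2_localError_le`). The network adds at most
`Λτ` to the Lipschitz constant of the base step, since restriction and prolongation do not increase
distances (`norm_toL2_hinStep_sub_le`). `discrete_gronwall_of_le` sums the local errors. Stability
is known only within `ρ` of the compact set, but `τ^γ ln(1/τ) → 0`, so for small `τ` the Gronwall
bound itself keeps the iterates in that range. Only the exact trajectory has to lie in the set. -/

theorem DispersiveEq.phase_add (E : DispersiveEq) (s t : ℝ) (k : ℤ) :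
    E.phase (s + t) k = E.phase s k * E.phase t k := by
  rw [phase, phase, phase, ← Complex.exp_add]
  congr 1
  push_cast
  ring

theorem DispersiveEq.continuous_phase (E : DispersiveEq) (k : ℤ) :
    Continuous fun t => E.phase t k := by
  unfold phase
  fun_prop

/-- Training quality concerns solutions starting at time 0; restarting `u` at a grid time makes it
applicable at every step. -/
theorem IsSolution.translate {E : DispersiveEq} {T : ℝ} {u : ℝ → Hs γ} (hu : IsSolution E T u)
    {s r : ℝ} (hs : 0 ≤ s) (hr : 0 ≤ r) (hsr : s + r ≤ T) :
    IsSolution E r fun t => u (s + t) := by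
  have hmaps : MapsTo (fun t => s + t) (Icc 0 r) (Icc 0 T) := fun t ht =>
    ⟨add_nonneg hs ht.1, by linarith [ht.2]⟩
  have hint : ∀ k, ∀ a ∈ Icc 0 T, ∀ b ∈ Icc 0 T,
      IntervalIntegrable (fun t => E.nonlinCoeff (u t) k) volume a b := fun k a ha b hb =>
    (hu.integrable_nonlin k).mono_set (by
      rw [uIcc_of_le (ha.1.trans ha.2)]
      exact uIcc_subset_Icc ha hb)
  have hsT : s ∈ Icc 0 T := ⟨hs, by linarith⟩
  refine ⟨hu.continuousOn.comp (by fun_prop) hmaps, ?_, ?_, ?_⟩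
  · have h := (ae_restrict_iff' measurableSet_Icc).1 hu.integrable_monomial
    rw [ae_restrict_iff' measurableSet_Icc]
    have h2 := (measurePreserving_add_left volume s).quasiMeasurePreserving.ae h
    filter_upwards [h2] with t ht htr
    exact ht (hmaps htr)
  · intro k
    have h := (hint k s hsT (s + r) ⟨by linarith, hsr⟩).comp_add_left s
    simpa using h
  · intro t ht k
    have hst := hmaps ht
    have h1 := hu.duhamel (s + t) hst k
    have h2 := hu.duhamel s hsT k
    have hph : ∀ a b c : ℝ, a ∈ Icc 0 T → b ∈ Icc 0 T → IntervalIntegrable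
        (fun σ => E.phase (c - σ) k * E.nonlinCoeff (u σ) k) volume a b := fun a b c ha hb =>
      (hint k a ha b hb).continuousOn_mul
        ((E.continuous_phase k).comp (by fun_prop : Continuous fun σ : ℝ => c - σ)).continuousOn
    have h0T : (0 : ℝ) ∈ Icc 0 T := ⟨le_rfl, hs.trans hsT.2⟩
    -- Cut the integral at `s`: the group law of the phase pulls `E.phase t k` out of the past, and
    -- a shift of variable turns the rest into the restarted integral.
    have hsplit : E.duhamelCoeff u (s + t) k
        = E.phase t k * E.duhamelCoeff u s k + E.duhamelCoeff (fun t => u (s + t)) t k := by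
      unfold DispersiveEq.duhamelCoeff
      rw [← intervalIntegral.integral_add_adjacent_intervals (hph 0 s (s + t) h0T hsT)
        (hph s (s + t) (s + t) hsT hst), ← intervalIntegral.integral_const_mul]
      congr 1
      · refine intervalIntegral.integral_congr fun σ _ => ?_
        rw [show s + t - σ = t + (s - σ) by ring, E.phase_add, mul_assoc]
      · have h := intervalIntegral.integral_comp_add_left (a := 0) (b := t)
          (fun σ => E.phase (s + t - σ) k * E.nonlinCoeff (u σ) k) s
        rw [add_zero] at h
        rw [← h]
        refine intervalIntegral.integral_congr fun σ _ => ?_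
        simp only
        rw [show s + t - (s + σ) = t - σ by ring]
    rw [E.hcoeff_propagator] at h1 h2 ⊢
    simp only [add_zero]
    rw [h1, h2, hsplit, add_comm s t, E.phase_add]
    ring

/-! ### Lipschitz continuity of the neural correction -/

theorem norm_le_mul_norm_of_components {d : ℕ} {c : ℝ} (hc : 0 ≤ c)
    {x y : EuclideanSpace ℂ (Fin d)} (h : ∀ i, ‖x i‖ ≤ c * ‖y i‖) : ‖x‖ ≤ c * ‖y‖ := by
  refine le_of_sq_le_sq ?_ (by positivity)
  rw [mul_pow, EuclideanSpace.norm_sq_eq, EuclideanSpace.norm_sq_eq, Finset.mul_sum]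
  refine Finset.sum_le_sum fun i _ => ?_
  rw [← mul_pow]
  exact pow_le_pow_left₀ (norm_nonneg _) (h i) 2

theorem Net.weightProd_nonneg {n p : ℕ} (G : Net n p) : 0 ≤ G.weightProd := by
  induction G with
  | input => exact zero_le_one
  | layer net W b s ih => exact mul_nonneg ih (norm_nonneg W)

/-- Biases cancel in differences, so each layer contributes a factor `κ * ‖W‖`. -/
theorem Net.norm_eval_sub_le {n p : ℕ} {κ : NNReal} (G : Net n p)
    (hG : G.ActivationsLipschitz κ) (x y : EuclideanSpace ℂ (Fin n)) :
    ‖G.eval x - G.eval y‖ ≤ (κ : ℝ) ^ G.depth * G.weightProd * ‖x - y‖ := by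
  induction G with
  | input => simp [Net.eval, Net.depth, Net.weightProd]
  | layer net W b s ih =>
    have hlip : ‖(Net.layer net W b s).eval x - (Net.layer net W b s).eval y‖
        ≤ κ * ‖W (net.eval x) + b - (W (net.eval y) + b)‖ :=
      norm_le_mul_norm_of_components κ.2 fun i => hG.2.norm_sub_le _ _
    calc _ ≤ κ * ‖W (net.eval x) + b - (W (net.eval y) + b)‖ := hlip
      _ = κ * ‖W (net.eval x - net.eval y)‖ := by rw [add_sub_add_right_eq_sub, map_sub]
      _ ≤ κ * (‖W‖ * ((κ : ℝ) ^ net.depth * net.weightProd * ‖x - y‖)) := by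
        gcongr
        exact (W.le_opNorm _).trans (by gcongr; exact ih hG.1)
      _ = _ := by
        simp only [Net.depth, Net.weightProd]
        ring

theorem gridMode_injective {N : ℕ} : Function.Injective (gridMode (N := N)) := by
  intro i j h
  unfold gridMode at h
  ext
  omega

theorem orthonormal_gridMode (N : ℕ) :
    Orthonormal ℂ fun j : Fin N => (fourierLp 2 (gridMode j) : L2T) :=
  orthonormal_fourier.comp _ gridMode_injective

/-- The C*-identity gives `‖Φ‖ ^ 2 = ‖1‖`. Equality with 1 would fail for `d = 0`. -/
theorem norm_le_one_of_conjTranspose_mul_self {N d : ℕ} {Φ : Matrix (Fin N) (Fin d) ℂ}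
    (hΦ : Φ.conjTranspose * Φ = 1) : ‖Φ‖ ≤ 1 := by
  have h := Matrix.l2_opNorm_conjTranspose_mul_self Φ
  have h1 : ‖(1 : Matrix (Fin d) (Fin d) ℂ)‖ ≤ 1 := by
    rw [← Matrix.diagonal_one, Matrix.l2_opNorm_diagonal]
    exact (pi_norm_le_iff_of_nonneg zero_le_one).2 fun i => by simp
  rw [hΦ] at h
  nlinarith [norm_nonneg Φ]

/-- Distinct exponentials are orthonormal, so the `L²` norm is the Euclidean norm of the coefficient
vector `Φ (x - y)`. -/
theorem norm_toL2_prolongation_sub_le {N d : ℕ} {Φ : Matrix (Fin N) (Fin d) ℂ}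
    (hΦ : Φ.conjTranspose * Φ = 1) (x y : EuclideanSpace ℂ (Fin d)) :
    ‖toL2 (prolongation Φ x - prolongation Φ y : Hs γ)‖ ≤ ‖x - y‖ := by
  have hsum : toL2 (prolongation Φ x - prolongation Φ y : Hs γ)
      = ∑ j, Φ.mulVec (x - y).ofLp j • (fourierLp 2 (gridMode j) : L2T) := by
    simp only [prolongation, map_sum, map_smul, ← Finset.sum_sub_distrib, ← sub_smul]
    refine Finset.sum_congr rfl fun j _ => ?_
    rw [WithLp.ofLp_sub, Matrix.mulVec_sub]
    rfl
  have hnorm : ‖toL2 (prolongation Φ x - prolongation Φ y : Hs γ)‖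
      = ‖WithLp.toLp 2 (Φ.mulVec (x - y).ofLp)‖ := by
    have hinner := (orthonormal_gridMode N).inner_sum
      (Φ.mulVec (x - y).ofLp) (Φ.mulVec (x - y).ofLp) Finset.univ
    simp only [inner_self_eq_norm_sq_to_K, RCLike.conj_mul] at hinner
    rw [hsum, ← sq_eq_sq₀ (norm_nonneg _) (norm_nonneg _), EuclideanSpace.norm_sq_eq]
    exact_mod_cast hinner
  rw [hnorm]
  exact (Matrix.l2_opNorm_mulVec Φ (x - y)).trans
    (mul_le_of_le_one_left (norm_nonneg _) (norm_le_one_of_conjTranspose_mul_self hΦ))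

/-- Bessel's inequality on the grid modes, combined with `‖Φ*‖ = ‖Φ‖ ≤ 1`. -/
theorem norm_restriction_sub_le {N d : ℕ} {Φ : Matrix (Fin N) (Fin d) ℂ}
    (hΦ : Φ.conjTranspose * Φ = 1) (v w : Hs γ) :
    ‖restriction Φ v - restriction Φ w‖ ≤ ‖toL2 (v - w)‖ := by
  have hsub : restriction Φ v - restriction Φ w
      = WithLp.toLp 2 (Φ.conjTranspose.mulVec fun j => hcoeff (v - w) (gridMode j)) := by
    rw [restriction, restriction, ← WithLp.toLp_sub, ← Matrix.mulVec_sub]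
    congr 2
    funext j
    have h := hcoeff_add (v - w) w (gridMode j)
    rw [sub_add_cancel] at h
    simp [h]
  rw [hsub]
  refine (Matrix.l2_opNorm_mulVec _
    (WithLp.toLp 2 fun j => hcoeff (v - w) (gridMode j))).trans ?_
  rw [Matrix.l2_opNorm_conjTranspose]
  refine (mul_le_of_le_one_left (norm_nonneg _)
    (norm_le_one_of_conjTranspose_mul_self hΦ)).trans ?_
  refine le_of_sq_le_sq ?_ (norm_nonneg _)
  rw [EuclideanSpace.norm_sq_eq]
  refine le_of_eq_of_le (Finset.sum_congr rfl fun j _ => ?_)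
    ((orthonormal_gridMode N).sum_inner_products_le (toL2 (v - w)) (s := Finset.univ))
  show ‖coeff (toL2 (v - w)) (gridMode j)‖ ^ 2 = _
  rw [coeff_eq_repr, fourierBasis.repr_apply_apply, coe_fourierBasis]

theorem norm_toL2_neural_sub_le {N d : ℕ} {Φ : Matrix (Fin N) (Fin d) ℂ}
    (hΦ : Φ.conjTranspose * Φ = 1) {G : Net d d} {κ : NNReal} (hG : G.ActivationsLipschitz κ)
    (v w : Hs γ) :
    ‖toL2 (neural Φ G v - neural Φ G w)‖
      ≤ (κ : ℝ) ^ G.depth * G.weightProd * ‖toL2 (v - w)‖ :=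
  (norm_toL2_prolongation_sub_le hΦ _ _).trans <| (G.norm_eval_sub_le hG _ _).trans <|
    mul_le_mul_of_nonneg_left (norm_restriction_sub_le hΦ v w)
      (mul_nonneg (pow_nonneg κ.2 _) G.weightProd_nonneg)

/-! ### Local error and stability of the corrected step -/

theorem norm_toL2_hinStep_sub_le {E : DispersiveEq} {I : ℝ → Hs γ → Hs γ} {K : Set (Hs γ)}
    {C₀ ρ τ₁ τ Λ : ℝ} (hstab : BaseStable E I K C₀ ρ τ₁) (hτ : τ ∈ Ioc 0 τ₁)
    {N d : ℕ} {Φ : Matrix (Fin N) (Fin d) ℂ} (hΦ : Φ.conjTranspose * Φ = 1)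
    {G : Net d d} {κ : NNReal} (hG : G.ActivationsLipschitz κ)
    (hΛ : (κ : ℝ) ^ G.depth * G.weightProd ≤ Λ)
    {v w : Hs γ} (hv : v ∈ K) (hvw : ‖toL2 (v - w)‖ ≤ ρ) :
    ‖toL2 (hinStep E I Φ G τ v - hinStep E I Φ G τ w)‖
      ≤ (1 + (C₀ + Λ) * τ) * ‖toL2 (v - w)‖ := by
  have h1 := hstab τ hτ v hv w hvw
  have h2 : ‖toL2 (neural Φ G v - neural Φ G w)‖ ≤ Λ * ‖toL2 (v - w)‖ :=
    (norm_toL2_neural_sub_le hΦ hG v w).trans (by gcongr)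
  have heq : toL2 (hinStep E I Φ G τ v - hinStep E I Φ G τ w)
      = toL2 (physStep E I τ v - physStep E I τ w)
        + (τ : ℂ) • toL2 (neural Φ G v - neural Φ G w) := by
    simp only [hinStep, map_sub, map_add, map_smul, smul_sub]
    abel
  rw [heq]
  refine (norm_add_le _ _).trans ?_
  rw [norm_smul, Complex.norm_real, Real.norm_of_nonneg hτ.1.le]
  nlinarith [mul_le_mul_of_nonneg_left h2 hτ.1.le]

theorem norm_toL2_localError_le {E : DispersiveEq} {I : ℝ → Hs γ → Hs γ} {K : Set (Hs γ)}
    {N d : ℕ} {Φ : Matrix (Fin N) (Fin d) ℂ} {G : Net d d} {C_D ε δ τ R T s : ℝ}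
    (hq : TrainingQuality E I K Φ G C_D ε δ τ) (hK : ∀ v ∈ K, ‖v‖ ≤ R)
    {u : ℝ → Hs γ} (hu : IsSolution E T u) (hs : 0 ≤ s) (hτ : 0 < τ) (hτ1 : τ ≤ 1)
    (hsT : s + τ ≤ T) (hus : u s ∈ K) (hC_D : 0 ≤ C_D) (hεδ : 0 ≤ ε + δ) :
    ‖toL2 (u (s + τ) - hinStep E I Φ G τ (u s))‖
      ≤ τ * (C_D * R ^ 3 * ((ε + δ) * (τ ^ γ * Real.log (1 / τ)))) := by
  have h := hq (fun t => u (s + t)) (hu.translate hs hτ.le hsT) (by simpa using hus)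
  have heq : u (s + τ) - hinStep E I Φ G τ (u s)
      = -((τ : ℂ) • neural Φ G (u s) - defect E I (fun t => u (s + t)) τ) := by
    simp only [hinStep, physStep, defect, exactIncrement, add_zero]
    abel
  simp only [add_zero] at h
  rw [heq, map_neg, norm_neg]
  refine h.trans ?_
  have hlog : 0 ≤ Real.log (1 / τ) := Real.log_nonneg ((one_le_div hτ).2 hτ1)
  have hR : ‖u s‖ ^ 3 ≤ R ^ 3 := pow_le_pow_left₀ (norm_nonneg _) (hK _ hus) 3
  calc (ε + δ) * (C_D * τ ^ (1 + γ) * Real.log (1 / τ) * ‖u s‖ ^ 3)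
      ≤ (ε + δ) * (C_D * τ ^ (1 + γ) * Real.log (1 / τ) * R ^ 3) := by gcongr
    _ = _ := by
      rw [Real.rpow_add hτ, Real.rpow_one]
      ring

/-- Discrete Gronwall inequality for a recursion which holds as long as the error is at most `ρ`. -/
theorem discrete_gronwall_of_le {e : ℕ → ℝ} {a τ η ρ T : ℝ} (hτ : 0 ≤ τ) (ha : 0 ≤ a)
    (hη : 0 ≤ η) (h0 : e 0 = 0) (hρ : T * Real.exp (a * T) * η ≤ ρ)
    (hstep : ∀ n : ℕ, (n + 1 : ℕ) * τ ≤ T → e n ≤ ρ → e (n + 1) ≤ (1 + a * τ) * e n + τ * η)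
    (n : ℕ) (hn : n * τ ≤ T) : e n ≤ T * Real.exp (a * T) * η := by
  have hexp : ∀ n : ℕ, n * τ ≤ T →
      n * τ * Real.exp (a * (n * τ)) * η ≤ T * Real.exp (a * T) * η := by
    intro n hn
    have : 0 ≤ n * τ := by positivity
    have : 0 ≤ T := this.trans hn
    gcongr
  -- The sharper bound, growing with `n * τ`, carries the induction; its uniform version `hexp`
  -- gives `e n ≤ ρ`, which unlocks the recursion at the next step.
  have key : ∀ n : ℕ, n * τ ≤ T → e n ≤ n * τ * Real.exp (a * (n * τ)) * η := by
    intro n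
    induction n with
    | zero => simp [h0]
    | succ n ih =>
      intro hn
      have hn' : n * τ ≤ T := by push_cast at hn; linarith
      have h1 := ih hn'
      have hE : Real.exp (a * ((n + 1 : ℕ) * τ)) = Real.exp (a * τ) * Real.exp (a * (n * τ)) := by
        rw [← Real.exp_add]
        push_cast
        ring_nf
      have h2 : 1 + a * τ ≤ Real.exp (a * τ) := by linarith [Real.add_one_le_exp (a * τ)]
      have h3 : 1 ≤ Real.exp (a * ((n + 1 : ℕ) * τ)) := Real.one_le_exp (by positivity)
      calc e (n + 1) ≤ (1 + a * τ) * e n + τ * η := hstep n hn (h1.trans ((hexp n hn').trans hρ))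
        _ ≤ (1 + a * τ) * (n * τ * Real.exp (a * (n * τ)) * η) + τ * η * 1 := by
          rw [mul_one]
          gcongr
        _ ≤ Real.exp (a * τ) * (n * τ * Real.exp (a * (n * τ)) * η)
            + τ * η * Real.exp (a * ((n + 1 : ℕ) * τ)) := by gcongr
        _ = (n + 1 : ℕ) * τ * Real.exp (a * ((n + 1 : ℕ) * τ)) * η := by
          rw [hE]
          push_cast
          ring
  exact (key n hn).trans (hexp n hn)

theorem exists_rpow_mul_log_inv_le {c : ℝ} (hγ : 0 < γ) (hc : 0 < c) :
    ∃ τ₀ : ℝ, 0 < τ₀ ∧ ∀ τ ∈ Ioc 0 τ₀, τ ^ γ * Real.log (1 / τ) ≤ c := by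
  have h := (tendsto_log_mul_rpow_nhdsGT_zero hγ).eventually (lt_mem_nhds (neg_lt_zero.2 hc))
  obtain ⟨τ₀, hτ₀, hsub⟩ := mem_nhdsGT_iff_exists_Ioc_subset.1 h
  refine ⟨τ₀, hτ₀, fun τ hτ => ?_⟩
  have h1 : -c < Real.log τ * τ ^ γ := hsub hτ
  rw [one_div, Real.log_inv]
  linarith

end HINLRI

theorem mainTheorem1 (γ T R C₀ C_D Λ : ℝ) (hγ : γ ∈ Set.Ioc (0 : ℝ) 1) (hT : 0 < T)
    (hC₀ : 0 ≤ C₀) (hC_D : 0 ≤ C_D) :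
    ∃ C : ℝ, 0 < C ∧ ∀ ρ τ₁ B : ℝ, 0 < ρ → 0 < τ₁ → ∃ τ₀ : ℝ, 0 < τ₀ ∧
      ∀ (E : HINLRI.DispersiveEq) (I : ℝ → HINLRI.Hs γ → HINLRI.Hs γ) (K : Set (HINLRI.Hs γ)),
        IsCompact K → (∀ v ∈ K, ‖v‖ ≤ R) →
        HINLRI.BaseConvergent E I K T τ₁ → HINLRI.BaseStable E I K C₀ ρ τ₁ →
      ∀ u : ℝ → HINLRI.Hs γ, HINLRI.IsSolution E T u → HINLRI.hcoeff (u 0) 0 = 0 →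
        (∀ t ∈ Set.Icc 0 T, u t ∈ K) →
      ∀ ε δ : ℝ, ε ∈ Set.Icc (0 : ℝ) 1 → 0 ≤ δ → ε + δ ≤ B →
      ∀ τ ∈ Set.Ioc 0 τ₀,
      ∀ (N d : ℕ) (Φ : Matrix (Fin N) (Fin d) ℂ) (G : HINLRI.Net d d) (κ : NNReal),
        Φ.conjTranspose * Φ = 1 →
        G.ActivationsLipschitz κ → (κ : ℝ) ^ G.depth * G.weightProd ≤ Λ →
        τ * G.weightProd < 1 →
        HINLRI.TrainingQuality E I K Φ G C_D ε δ τ →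
      ∀ n : ℕ, 1 ≤ n → n * τ ≤ T →
        ‖HINLRI.toL2 (u (n * τ) - (HINLRI.hinStep E I Φ G τ)^[n] (u 0))‖
          ≤ C * (ε + δ) * τ ^ γ * Real.log (1 / τ) := by
  obtain ⟨hγ0, -⟩ := hγ
  -- No sign is assumed for `Λ` or `R`, hence the absolute values.
  set L : ℝ := C₀ + |Λ|
  have hL : 0 ≤ L := add_nonneg hC₀ (abs_nonneg Λ)
  -- The Gronwall constant; adding 1 keeps it positive when `C_D` or `R` vanishes.
  set C : ℝ := T * Real.exp (L * T) * (C_D * |R| ^ 3) + 1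
  have hC : 0 < C := by positivity
  refine ⟨C, hC, fun ρ τ₁ B hρ hτ₁ => ?_⟩
  -- This threshold makes the final error bound at most `ρ` whenever `ε + δ ≤ B`, as the bootstrap
  -- needs.
  obtain ⟨τ₂, hτ₂, hsmall⟩ :=
    HINLRI.exists_rpow_mul_log_inv_le hγ0 (c := ρ / (C * (|B| + 1))) (by positivity)
  -- The cap at 1 keeps `log (1 / τ)` nonnegative.
  refine ⟨min (min τ₁ τ₂) 1, by positivity, ?_⟩
  intro E I K _ hK _ hstab u hu _ huK ε δ hε hδ hB τ hτ N d Φ G κ hΦ hG hΛ _ hq n _ hn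
  have hτ0 : 0 < τ := hτ.1
  have hτ1 : τ ≤ 1 := hτ.2.trans (min_le_right _ _)
  have hττ₁ : τ ≤ τ₁ := hτ.2.trans ((min_le_left _ _).trans (min_le_left _ _))
  have hττ₂ : τ ≤ τ₂ := hτ.2.trans ((min_le_left _ _).trans (min_le_right _ _))
  have hεδ : 0 ≤ ε + δ := add_nonneg hε.1 hδ
  have hlog : 0 ≤ Real.log (1 / τ) := Real.log_nonneg ((one_le_div hτ0).2 hτ1)
  set q : ℝ := τ ^ γ * Real.log (1 / τ) with hqdef
  have hq0 : 0 ≤ q := by positivity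
  set η : ℝ := C_D * |R| ^ 3 * ((ε + δ) * q) with hηdef
  have hη : 0 ≤ η := by positivity
  have hbound : T * Real.exp (L * T) * η ≤ C * ((ε + δ) * q) := by
    have : C * ((ε + δ) * q) = T * Real.exp (L * T) * η + (ε + δ) * q := by
      simp only [C, η]
      ring
    rw [this]
    exact le_add_of_nonneg_right (by positivity)
  have hρle : T * Real.exp (L * T) * η ≤ ρ := by
    have hqs : q ≤ ρ / (C * (|B| + 1)) := hsmall τ ⟨hτ0, hττ₂⟩
    rw [le_div_iff₀ (by positivity)] at hqs
    have hB' : ε + δ ≤ |B| + 1 := by linarith [le_abs_self B]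
    calc _ ≤ C * ((ε + δ) * q) := hbound
      _ ≤ C * ((|B| + 1) * q) := by gcongr
      _ = q * (C * (|B| + 1)) := by ring
      _ ≤ ρ := hqs
  have hmain := HINLRI.discrete_gronwall_of_le
    (e := fun n => ‖HINLRI.toL2 (u (n * τ) - (HINLRI.hinStep E I Φ G τ)^[n] (u 0))‖)
    hτ0.le hL hη (by simp) hρle (fun m hm hmρ => ?_) n hn
  · calc _ ≤ T * Real.exp (L * T) * η := hmain
      _ ≤ C * ((ε + δ) * q) := hbound
      _ = _ := by rw [hqdef]; ring
  · have hms : (m + 1 : ℕ) * τ = m * τ + τ := by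
      push_cast
      ring
    have hm0 : 0 ≤ m * τ := by positivity
    have hmT : m * τ + τ ≤ T := hms ▸ hm
    have humK : u (m * τ) ∈ K := huK _ ⟨hm0, by linarith⟩
    have hloc := HINLRI.norm_toL2_localError_le hq
      (fun v hv => (hK v hv).trans (le_abs_self R)) hu hm0 hτ0 hτ1 hmT humK hC_D hεδ
    have hst := HINLRI.norm_toL2_hinStep_sub_le hstab ⟨hτ0, hττ₁⟩ hΦ hG
      (hΛ.trans (le_abs_self Λ)) humK hmρ
    simp only [Function.iterate_succ_apply', hms]
    -- Inserting the corrected step from the exact value splits the error into the local error and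
    -- the propagated earlier error; stability applies because that value lies in `K`.
    rw [← sub_add_sub_cancel _ (HINLRI.hinStep E I Φ G τ (u (m * τ))), map_add]
    refine (norm_add_le _ _).trans ?_
    rw [add_comm]
    exact add_le_add hst hloc
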